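/- Let $p$ be a prime and let $\mathbb C$ be a complete, non-archimedean, algebraically closed field of mixed characteristic $(0,p)$, with ring of integers $\mathcal O$, maximal ideal $\mathfrak m$ and residue field $k$. Let $\mathcal O^\flat=\varprojlim_{x\mapsto x^p}\mathcal O/p\mathcal O$ be its tilt and $\mathbb A_{\mathrm{inf}}=W(\mathcal O^\flat)$, with Witt vector Frobenius $\phi$. View $W(k)$ as an $\mathbb A_{\mathrm{inf}}$-algebra through the map $W(\mathcal O^\flat)\to W(k)$ induced by $\mathcal O^\flat\to\mathcal O/p\mathcal O\to k$, $(x_0,x_1,\dots)\mapsto x_0 \bmod \mathfrak m$. Fix a compatible system $\zeta_p,\zeta_{p^2},\dots\in\mathcal O$ of primitive $p$-power roots of unity (so $\zeta_{p^{n+1}}^p=\zeta_{p^n}$) and put $$\varepsilon=(1,\zeta_p,\zeta_{p^2},\dots)\in\mathcal O^\flat,\qquad \mu=[\varepsilon]-1\in\mathbb A_{\mathrm{inf}},\qquad \xi=1+[\varepsilon^{1/p}]+[\varepsilon^{1/p}]^2+\cdots+[\varepsilon^{1/p}]^{p-1}\in\mathbb A_{\mathrm{inf}}.$$ Let $M$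 be a finitely presented $\mathbb A_{\mathrm{inf}}$-module, and assume: 1. $M[\tfrac1{p\mu}]$ is a finite free $\mathbb A_{\mathrm{inf}}[\tfrac1{p\mu}]$-module of the same rank as the $W(k)$-module $M\otimes_{\mathbb A_{\mathrm{inf}}}W(k)$ (where the rank of a finitely generated $W(k)$-module $N$ is $\dim_{\operatorname{Frac}W(k)}(N\otimes_{W(k)}\operatorname{Frac}W(k))$); 2. there exists a $\phi$-semi-linear endomorphism $f:M\to M$ which becomes an isomorphism after inverting $\xi$, i.e. such that the induced map $M[\tfrac1\xi]\to M[\tfrac1{\phi(\xi)}]$, $x/\xi^n\mapsto f(x)/\phi(\xi)^n$, is bijective. Then $M[\tfrac1p]$ is a finite free $\mathbb A_{\mathrm{inf}}[\tfrac1p]$-module. -/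

import Mathlib

open scoped TensorProduct

noncomputable section

namespace AInfModules

/-! ### Localizing a semilinear map -/

section Semilinear

variable {R R' M M' : Type*} [CommRing R] [CommRing R'] [AddCommGroup M] [Module R M]
  [AddCommGroup M'] [Module R' M']

/-- The map `S⁻¹M → T⁻¹M'`, `x / s ↦ f x / σ s`, induced by a `σ`-semilinear map `f : M → M'`,
where `σ` carries `S` into `T`. -/
def localizedMap {σ : R →+* R'} (f : M →ₛₗ[σ] M') (S : Submonoid R) (T : Submonoid R')
    (hST : S ≤ T.comap σ) : LocalizedModule S M →ₛₗ[σ] LocalizedModule T M' where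
  toFun x := x.liftOn (fun q => LocalizedModule.mk (f q.1) (⟨σ q.2, hST q.2.2⟩ : T)) (by
    rintro ⟨m, s⟩ ⟨m', s'⟩ ⟨u, hu⟩
    rw [LocalizedModule.mk_eq]
    refine ⟨⟨σ u, hST u.2⟩, ?_⟩
    have h := congrArg f hu
    simp only [Submonoid.smul_def, map_smulₛₗ] at h
    simpa only [Submonoid.smul_def] using h)
  map_add' x y := by
    induction x with | _ m s
    induction y with | _ m' s'
    simp only [LocalizedModule.mk_add_mk, LocalizedModule.liftOn_mk]
    congr 1
    · simp only [Submonoid.smul_def, map_add, map_smulₛₗ]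
    · ext; simp
  map_smul' r x := by
    induction x with | _ m s
    simp only [LocalizedModule.smul'_mk, LocalizedModule.liftOn_mk, map_smulₛₗ]

@[simp]
theorem localizedMap_mk {σ : R →+* R'} (f : M →ₛₗ[σ] M') (S : Submonoid R) (T : Submonoid R')
    (hST : S ≤ T.comap σ) (m : M) (s : S) :
    localizedMap f S T hST (LocalizedModule.mk m s) =
      LocalizedModule.mk (f m) ⟨σ s, hST s.2⟩ := rfl

theorem powers_le_comap (σ : R →+* R') (a : R) :
    Submonoid.powers a ≤ (Submonoid.powers (σ a)).comap σ := by
  rintro _ ⟨n, rfl⟩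
  exact ⟨n, by simp⟩

/-- The map `M[1/a] → M'[1/σ(a)]`, `x / aⁿ ↦ f x / σ(a)ⁿ`, induced by a `σ`-semilinear map
`f : M → M'`. -/
def awayMap {σ : R →+* R'} (f : M →ₛₗ[σ] M') (a : R) :
    LocalizedModule.Away a M →ₛₗ[σ] LocalizedModule.Away (σ a) M' :=
  localizedMap f (Submonoid.powers a) (Submonoid.powers (σ a)) (powers_le_comap σ a)

end Semilinear

/-! ### The rings `𝒪`, `k`, `𝒪♭`, `𝔸_inf` -/

section Rings

variable (C : Type*) [NormedField C] [IsUltrametricDist C]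

/-- The ring of integers `𝒪 = {x | ‖x‖ ≤ 1}` of a non-archimedean field `C`. -/
abbrev RingOfIntegers : ValuationSubring C :=
  (NormedField.valuation (K := C)).valuationSubring

/-- The residue field `k` of `𝒪`. -/
abbrev Residue : Type _ := IsLocalRing.ResidueField (RingOfIntegers C)

variable (p : ℕ) [Fact p.Prime] [Fact (¬ IsUnit (p : RingOfIntegers C))]

/-- The tilt `𝒪♭`, the inverse limit of `𝒪/p𝒪` along the Frobenius. -/
abbrev Tilt : Type _ := PreTilt (RingOfIntegers C) p

/-- Fontaine's ring `𝔸_inf = W(𝒪♭)`. -/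
abbrev AInf : Type _ := WittVector p (Tilt C p)

/-- The Witt vector Frobenius `φ` of `𝔸_inf`. -/
abbrev frob : AInf C p →+* AInf C p := WittVector.frobenius

/-- The canonical projection `𝒪/p𝒪 → k`. -/
def modPToResidue : ModP (RingOfIntegers C) p →+* Residue C :=
  Ideal.Quotient.lift _ (IsLocalRing.residue (RingOfIntegers C)) (by
    intro a ha
    obtain ⟨b, rfl⟩ := Ideal.mem_span_singleton'.mp ha
    rw [IsLocalRing.residue_eq_zero_iff]
    refine Ideal.mul_mem_left _ _ ?_
    rw [IsLocalRing.mem_maximalIdeal]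
    exact (Fact.out : ¬ IsUnit (p : RingOfIntegers C)))

/-- The canonical projection `𝒪♭ → 𝒪/p𝒪 → k`, `(x₀, x₁, …) ↦ x₀ mod 𝔪`. -/
def tiltToResidue : Tilt C p →+* Residue C :=
  (modPToResidue C p).comp (PreTilt.coeff 0)

/-- The crystalline specialisation `𝔸_inf = W(𝒪♭) → W(k)`. -/
def crystalline : AInf C p →+* WittVector p (Residue C) :=
  WittVector.map (tiltToResidue C p)

/-- `W(k)` is an `𝔸_inf`-algebra through the crystalline specialisation. -/
instance : Algebra (AInf C p) (WittVector p (Residue C)) := (crystalline C p).toAlgebra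

end Rings

/-! ### The elements `ε`, `μ`, `ξ` -/

section Elements

/-- A compatible system `ζ_p, ζ_{p²}, …` of primitive `p`-power roots of unity in `𝒪`
(with `ζ_{p⁰} = 1`). -/
structure RootSystem (C : Type*) [NormedField C] [IsUltrametricDist C] (p : ℕ) where
  /-- `ζ n` is the primitive `pⁿ`-th root of unity `ζ_{pⁿ}`. -/
  ζ : ℕ → RingOfIntegers C
  primitive : ∀ n, IsPrimitiveRoot (ζ n) (p ^ n)
  compat : ∀ n, ζ (n + 1) ^ p = ζ n

variable {C : Type*} [NormedField C] [IsUltrametricDist C]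
  {p : ℕ} [Fact p.Prime] [Fact (¬ IsUnit (p : RingOfIntegers C))]

namespace RootSystem

/-- `ε = (1, ζ_p, ζ_{p²}, …) ∈ 𝒪♭`. -/
def ε (z : RootSystem C p) : Tilt C p :=
  ⟨fun n => Ideal.Quotient.mk _ (z.ζ n), fun n => by rw [← map_pow, z.compat]⟩

/-- `μ = [ε] - 1 ∈ 𝔸_inf`. -/
def μ (z : RootSystem C p) : AInf C p :=
  WittVector.teichmuller p z.ε - 1

/-- `ξ = 1 + [ε^{1/p}] + [ε^{1/p}]² + ⋯ + [ε^{1/p}]^{p-1} ∈ 𝔸_inf`. -/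
def ξ (z : RootSystem C p) : AInf C p :=
  ∑ i ∈ Finset.range p, WittVector.teichmuller p ((frobeniusEquiv (Tilt C p) p).symm z.ε) ^ i

end RootSystem

end Elements

end AInfModules

end

noncomputable section

namespace AInfModules

/-! ### Principal adic completeness and valuation rings -/

section Adic

variable {A : Type*} [CommRing A] {π : A}

/-! Write `A = 𝔸_inf`, `W = W(k)`, let `κ : A → W` be the crystalline specialisation and `m` the
common rank.

Frobenius spreads generators from the crystalline point. Since `φ(ξ) ≡ p` modulo `μ`, surjectivity
of `f` after localization says that `f(M)`, and then every `fⁿ(M)`, spans `M` up to a power of `p`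
modulo `μ`. Lift to `e₁, …, e_m ∈ M` elements spanning `W ⊗ M` up to torsion; they span `M` up to a
power of `p` modulo `ker κ`. High powers of `φ` push `ker κ` into `(p^(c+1), μ)`, so by Nakayama the
elements `hᵢ = fⁿ(eᵢ)` span `M` up to a power of `p` modulo `μ`
(`exists_pow_smul_mem_span_iterateMap`). Cayley–Hamilton removes "modulo `μ`": some `s`, congruent
to a power of `p` modulo `μ`, satisfies `sM ⊆ ⟨h⟩`. In particular `κ s ≠ 0`.

The `hᵢ` are independent because `M[1/pμ]` is free of rank `m`. Coordinates along `h` give `θ : M →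
A^m` whose kernel is `p`-power torsion and whose image `P` contains `sA^m`. It remains to see that
`P[1/p]` is free (`exists_basis_saturation`). Let `b ⊆ P` be a basis after inverting `pμ`, and
replace `P` by its saturation: the vectors of `A^m` lying in `P[1/p]` and in `⟨b⟩[1/μ]`. Its image
in `W^m` is free of rank `m` since `W` is a principal ideal domain. Lifts of a basis of that image
generate the saturation modulo `p`, because `A/p = 𝒪♭` is a valuation ring, and hence generate it by
`p`-adic completeness. -/

theorem sModEq_span_pow_iff (x y : A) (n : ℕ) :
    x ≡ y [SMOD (Ideal.span {π} ^ n • ⊤ : Submodule A A)] ↔ π ^ n ∣ x - y := by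
  rw [SModEq.sub_mem, smul_eq_mul, Ideal.mul_top, Ideal.span_singleton_pow,
    Ideal.mem_span_singleton]

theorem eq_zero_of_forall_pow_dvd [IsHausdorff (Ideal.span {π}) A] {x : A}
    (h : ∀ n, π ^ n ∣ x) : x = 0 :=
  IsHausdorff.haus' (I := Ideal.span {π}) x fun n => by
    rw [sModEq_span_pow_iff, sub_zero]
    exact h n

theorem exists_pow_dvd_sub [IsPrecomplete (Ideal.span {π}) A] (a : ℕ → A) :
    ∃ L, ∀ n, π ^ n ∣ (∑ k ∈ Finset.range n, π ^ k * a k) - L := by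
  obtain ⟨L, hL⟩ := IsPrecomplete.prec (I := Ideal.span {π}) (M := A) inferInstance
    (f := fun n => ∑ k ∈ Finset.range n, π ^ k * a k) (by
      intro m n hmn
      rw [sModEq_span_pow_iff, ← neg_sub, dvd_neg, Finset.sum_range_sub_sum_range hmn]
      refine Finset.dvd_sum fun k hk => Dvd.dvd.mul_right (pow_dvd_pow _ ?_) _
      simp only [Finset.mem_filter] at hk
      exact hk.2)
  exact ⟨L, fun n => (sModEq_span_pow_iff _ _ _).1 (hL n)⟩

/-- Successive approximation: a submodule of `A^n` which is generated by a finite family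
modulo `π` is generated by it. -/
theorem exists_eq_sum_of_forall_exists_eq_add [IsAdicComplete (Ideal.span {π}) A]
    {ι κ : Type*} [Fintype ι] (N : Submodule A (κ → A)) (x : ι → κ → A)
    (h : ∀ y ∈ N, ∃ a : ι → A, ∃ y' ∈ N, y = ∑ i, a i • x i + π • y') :
    ∀ y ∈ N, ∃ a : ι → A, y = ∑ i, a i • x i := by
  choose! a r hr ha using h
  intro y hy
  have hmem : ∀ n, r^[n] y ∈ N := fun n => by
    induction n with
    | zero => exact hy
    | succ n ih => rw [Function.iterate_succ_apply']; exact hr _ ih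
  have hsum : ∀ n, y = ∑ i, (∑ k ∈ Finset.range n, π ^ k * a (r^[k] y) i) • x i +
      π ^ n • r^[n] y := fun n => by
    induction n with
    | zero => simp
    | succ n ih =>
      conv_lhs => rw [ih, ha _ (hmem n)]
      rw [Function.iterate_succ_apply']
      simp only [Finset.sum_range_succ, add_smul, Finset.sum_add_distrib, smul_add,
        Finset.smul_sum, smul_smul, pow_succ, add_assoc]
  choose L hL using fun i => exists_pow_dvd_sub (π := π) fun k => a (r^[k] y) i
  refine ⟨L, funext fun j => sub_eq_zero.1 (eq_zero_of_forall_pow_dvd (π := π) fun n => ?_)⟩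
  have h1 := congrFun (hsum n) j
  simp only [Pi.add_apply, Finset.sum_apply, Pi.smul_apply, smul_eq_mul] at h1 ⊢
  rw [h1, add_sub_right_comm, ← Finset.sum_sub_distrib]
  simp only [← sub_mul]
  exact dvd_add (Finset.dvd_sum fun i _ => (hL i n).mul_right _) (dvd_mul_right _ _)

/-- In a valuation ring, a nonzero finite family is a multiple of a family containing `1`. -/
theorem exists_eq_mul_of_ne_zero {R ι : Type*} [CommRing R] [IsDomain R] [ValuationRing R]
    [Finite ι] (c : ι → R) (hc : c ≠ 0) :
    ∃ d : R, d ≠ 0 ∧ ∃ c' : ι → R, (∀ i, c i = d * c' i) ∧ ∃ i, c' i = 1 := by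
  obtain ⟨i₀, hi₀⟩ := Function.ne_iff.1 hc
  have : Nonempty ι := ⟨i₀⟩
  have : IsTrans R fun a b => b ∣ a := ⟨fun _ _ _ h₁ h₂ => h₂.trans h₁⟩
  have hdir : Directed (fun a b : R => b ∣ a) c := fun i j => by
    rcases ValuationRing.dvd_total (c i) (c j) with h | h
    · exact ⟨i, dvd_rfl, h⟩
    · exact ⟨j, h, dvd_rfl⟩
  obtain ⟨z, hz⟩ := hdir.finite_le id
  have hz0 : c z ≠ 0 := fun h => hi₀ (by simpa [h] using hz i₀)
  choose c' hc' using hz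
  exact ⟨c z, hz0, c', hc', z, mul_left_cancel₀ hz0 (by rw [← hc', mul_one]; rfl)⟩

end Adic

/-! ### Saturating a lattice -/

/-- A domain `A` with an element `π` such that `A/π` is a valuation ring `R`, together with a
specialisation `κ` of `A` to a principal ideal domain `W`, refining `R → R/𝔪` modulo `π`, which
kills an element `μ` not divisible by `π`. -/
structure IsSpecialization {A R W : Type*} [CommRing A] [CommRing R] [CommRing W]
    (q : A →+* R) (κ : A →+* W) (π μ : A) : Prop where
  surjective : Function.Surjective q
  eq_zero_iff : ∀ a, q a = 0 ↔ π ∣ a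
  map_ne_zero : q μ ≠ 0
  specialize_surjective : Function.Surjective κ
  specialize_eq_zero : κ μ = 0
  specialize_ne_zero : κ π ≠ 0
  not_isUnit : ¬ IsUnit (κ π)
  isUnit_or : ∀ a, IsUnit (q a) ∨ κ π ∣ κ a

namespace IsSpecialization

variable {A R W : Type*} [CommRing A] [CommRing R] [CommRing W] {q : A →+* R} {κ : A →+* W}
  {π μ : A}

theorem ne_zero (h : IsSpecialization q κ π μ) : π ≠ 0 := fun h0 =>
  h.specialize_ne_zero (by rw [h0, map_zero])

theorem prime [IsDomain R] (h : IsSpecialization q κ π μ) : Prime π := by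
  refine ⟨h.ne_zero, fun hu => h.not_isUnit (hu.map κ), fun a b hab => ?_⟩
  rw [← h.eq_zero_iff] at hab
  rw [map_mul] at hab
  exact (mul_eq_zero.1 hab).imp (h.eq_zero_iff a).1 (h.eq_zero_iff b).1

theorem not_dvd (h : IsSpecialization q κ π μ) : ¬ π ∣ μ := fun hd =>
  h.map_ne_zero ((h.eq_zero_iff μ).2 hd)

theorem dvd_of_dvd_pow_mul [IsDomain A] [IsDomain R] (h : IsSpecialization q κ π μ) {n N : ℕ}
    {a : A} (hd : π ^ n ∣ μ ^ N * a) : π ^ n ∣ a :=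
  h.prime.pow_dvd_of_dvd_mul_left n (fun hd => h.not_dvd (h.prime.dvd_of_dvd_pow hd)) hd

end IsSpecialization

/-- Coordinatewise specialisation. -/
def specialize {A W : Type*} [CommRing A] [CommRing W] (κ : A →+* W) (m : ℕ) :
    (Fin m → A) →ₛₗ[κ] (Fin m → W) where
  toFun x i := κ (x i)
  map_add' x y := by ext; simp
  map_smul' a x := by ext; simp

@[simp]
theorem specialize_apply {A W : Type*} [CommRing A] [CommRing W] {m : ℕ} (κ : A →+* W)
    (x : Fin m → A) (i : Fin m) :
    specialize κ m x i = κ (x i) := rfl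

section Saturation

variable {A R W : Type*} [CommRing A] [CommRing R] [CommRing W]
  {q : A →+* R} {κ : A →+* W} {π μ : A} {m : ℕ}

/-- The elements of `A^m` which lie in `P` after inverting `π` and in the span of the family `b`
after inverting `μ`. -/
def saturation (π μ : A) (P : Submodule A (Fin m → A)) (b : Fin m → Fin m → A) :
    Submodule A (Fin m → A) where
  carrier := {x | (∃ j : ℕ, π ^ j • x ∈ P) ∧
    ∃ j : ℕ, μ ^ j • x ∈ Submodule.span A (Set.range b)}
  zero_mem' := ⟨⟨0, by simp⟩, 0, by simp⟩
  add_mem' := by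
    rintro x y ⟨⟨i, hi⟩, j, hj⟩ ⟨⟨i', hi'⟩, j', hj'⟩
    refine ⟨⟨i + i', ?_⟩, j + j', ?_⟩ <;> rw [smul_add]
    · refine add_mem ?_ ?_
      · rw [pow_add, mul_comm, mul_smul]; exact Submodule.smul_mem _ _ hi
      · rw [pow_add, mul_smul]; exact Submodule.smul_mem _ _ hi'
    · refine add_mem ?_ ?_
      · rw [pow_add, mul_comm, mul_smul]; exact Submodule.smul_mem _ _ hj
      · rw [pow_add, mul_smul]; exact Submodule.smul_mem _ _ hj'
  smul_mem' := by
    rintro a x ⟨⟨i, hi⟩, j, hj⟩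
    refine ⟨⟨i, ?_⟩, j, ?_⟩ <;> rw [smul_comm] <;> exact Submodule.smul_mem _ _ ‹_›

variable {P : Submodule A (Fin m → A)} {b : Fin m → Fin m → A}

/-- The point is that one exponent `N` serves the whole saturation. The two expansions of `x`, one
with denominator a power of `πμ`, the other with denominator a power of `μ`, have proportional
coordinates. As `π` is prime and does not divide `μ`, the powers of `π` cancel from the first. -/
theorem exists_coordinates [IsDomain A] [IsDomain R] (h : IsSpecialization q κ π μ)
    (hb : LinearIndependent A b) {N : ℕ}
    (hN : ∀ x ∈ P, (π * μ) ^ N • x ∈ Submodule.span A (Set.range b))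
    {x : Fin m → A} (hx : x ∈ saturation π μ P b) :
    ∃ u : Fin m → A, μ ^ N • x = ∑ i, u i • b i := by
  obtain ⟨⟨i, hi⟩, j, hj⟩ := hx
  obtain ⟨u, hu⟩ := (Submodule.mem_span_range_iff_exists_fun A).1 (hN _ hi)
  obtain ⟨v, hv⟩ := (Submodule.mem_span_range_iff_exists_fun A).1 hj
  have key : ∀ l, μ ^ j * u l = π ^ (N + i) * (μ ^ N * v l) := by
    have : ∑ l, (μ ^ j * u l - π ^ (N + i) * (μ ^ N * v l)) • b l = 0 := by
      simp only [sub_smul, Finset.sum_sub_distrib, mul_smul, ← Finset.smul_sum, hu, hv]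
      simp only [smul_smul, ← sub_smul]
      convert zero_smul A x using 2
      ring
    exact fun l => sub_eq_zero.1 (Fintype.linearIndependent_iff.1 hb _ this l)
  have hdvd : ∀ l, π ^ (N + i) ∣ u l := fun l =>
    h.dvd_of_dvd_pow_mul (N := j) ⟨_, key l⟩
  choose w hw using hdvd
  refine ⟨w, smul_right_injective _ (pow_ne_zero (N + i) h.ne_zero) ?_⟩
  simp only [Finset.smul_sum, smul_smul, ← hw, hu]
  congr 1
  ring

/-- Divisibility by `π` of the `b`-coordinates passes to the vector itself, since `μ ^ N` is prime
to `π`. Both defining conditions of the saturation survive division by `π`. -/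
theorem exists_eq_smul_of_coordinates [IsDomain A] [IsDomain R]
    (h : IsSpecialization q κ π μ) {N : ℕ}
    {x : Fin m → A} (hx : x ∈ saturation π μ P b) {u : Fin m → A} (hu : ∀ i, π ∣ u i)
    (hxu : μ ^ N • x = ∑ i, u i • b i) : ∃ y ∈ saturation π μ P b, x = π • y := by
  choose v hv using hu
  have hd : ∀ l, π ∣ x l := fun l => by
    have h1 := congrFun hxu l
    simp only [Finset.sum_apply, Pi.smul_apply, smul_eq_mul] at h1
    have h2 : π ^ 1 ∣ μ ^ N * x l := by
      rw [h1, pow_one]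
      exact Finset.dvd_sum fun i _ => ⟨v i * b i l, by rw [hv, mul_assoc]⟩
    simpa using h.dvd_of_dvd_pow_mul h2
  choose y hy using hd
  have hxy : x = π • y := funext hy
  refine ⟨y, ⟨?_, N, ?_⟩, hxy⟩
  · obtain ⟨⟨i, hi⟩, -⟩ := hx
    refine ⟨i + 1, ?_⟩
    rwa [pow_succ, mul_smul, ← hxy]
  · have : μ ^ N • y = ∑ i, v i • b i := by
      apply smul_right_injective _ h.ne_zero
      simp only [Finset.smul_sum, smul_smul, ← hv]
      rw [← hxu, hxy, smul_smul, mul_comm]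
    rw [this]
    exact sum_mem fun i _ => Submodule.smul_mem _ _ (Submodule.subset_span ⟨i, rfl⟩)

/-- Independence of `m` vectors in rank `m` over a domain is nonvanishing of a determinant, and
determinants commute with `κ`. -/
theorem linearIndependent_of_specialize [IsDomain A] [IsDomain W] {x : Fin m → Fin m → A}
    (hx : LinearIndependent W fun i => specialize κ m (x i)) : LinearIndependent A x := by
  by_contra hcon
  obtain ⟨a, ha, i, hi⟩ := Fintype.not_linearIndependent_iff.1 hcon
  have hdet : (Matrix.of x).det = 0 := Matrix.exists_vecMul_eq_zero_iff.1
    ⟨a, fun h0 => hi (by simp [h0]), by rw [Matrix.vecMul_eq_sum]; exact ha⟩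
  have hdet' : ((Matrix.of x).map κ).det = 0 := by
    have := congrArg κ hdet
    rwa [RingHom.map_det, map_zero] at this
  obtain ⟨w, hw, hw0⟩ := Matrix.exists_vecMul_eq_zero_iff.2 hdet'
  refine hw (funext fun j => Fintype.linearIndependent_iff.1 hx w ?_ j)
  rw [Matrix.vecMul_eq_sum] at hw0
  exact hw0

/-- The image `T` of the saturation in `W^m` contains `κ(π ^ N * s) W^m`, so it has rank `m`. It is
free over the principal ideal domain `W`, and the family `x` lifts a basis of it. -/
theorem exists_basis_specialize_saturation [IsDomain W] [IsPrincipalIdealRing W]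
    (h : IsSpecialization q κ π μ) {N : ℕ}
    (hN : ∀ x ∈ P, (π * μ) ^ N • x ∈ Submodule.span A (Set.range b))
    {s : A} (hs : κ s ≠ 0) (hsP : ∀ i, s • Pi.single i 1 ∈ P) :
    ∃ x : Fin m → Fin m → A, (∀ i, x i ∈ saturation π μ P b) ∧
      LinearIndependent W (fun i => specialize κ m (x i)) ∧
      ∀ y ∈ saturation π μ P b, ∃ w : Fin m → W,
        specialize κ m y = ∑ i, w i • specialize κ m (x i) := by
  have : RingHomSurjective κ := ⟨h.specialize_surjective⟩
  set T : Submodule W (Fin m → W) := (saturation π μ P b).map (specialize κ m)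
  obtain ⟨n, ⟨t⟩⟩ := Submodule.nonempty_basis_of_pid (Pi.basisFun W (Fin m)) T
  have hmem : ∀ x ∈ P, π ^ N • x ∈ saturation π μ P b := fun x hx =>
    ⟨⟨0, Submodule.smul_mem _ _ (Submodule.smul_mem _ _ hx)⟩, N, by
      rw [smul_smul, ← mul_pow, mul_comm]; exact hN x hx⟩
  have hsmul : ∀ v : Fin m → W, κ (π ^ N * s) • v ∈ T := fun v => by
    have hv : v = ∑ i, v i • Pi.single i 1 := by
      ext j; simp [Finset.sum_apply, Pi.single_apply]
    rw [hv, Finset.smul_sum]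
    refine sum_mem fun i _ => ?_
    rw [smul_comm]
    refine Submodule.smul_mem _ _ ⟨π ^ N • s • Pi.single i 1, hmem _ (hsP i), ?_⟩
    ext j
    simp [Pi.single_apply, apply_ite κ]
  have hne : κ (π ^ N * s) ≠ 0 := by
    rw [map_mul, map_pow]; exact mul_ne_zero (pow_ne_zero _ h.specialize_ne_zero) hs
  have hrank : Module.finrank W T = m := by
    refine le_antisymm ?_ ?_
    · simpa using Submodule.finrank_le T
    · let g : (Fin m → W) →ₗ[W] T :=
        (LinearMap.lsmul W (Fin m → W) (κ (π ^ N * s))).codRestrict T hsmul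
      have : Module.Finite W T := Module.Finite.of_basis t
      have hg : Function.Injective g := fun v v' hvv' =>
        smul_right_injective _ hne (congrArg Subtype.val hvv')
      simpa using LinearMap.finrank_le_finrank_of_injective hg
  obtain rfl : n = m := by
    rw [← hrank, Module.finrank_eq_card_basis t, Fintype.card_fin]
  have hx : ∀ i, ∃ x ∈ saturation π μ P b, specialize κ n x = t i := fun i => (t i).2
  choose x hx hxt using hx
  refine ⟨x, hx, ?_, fun y hy => ?_⟩
  · simp only [hxt]
    exact t.linearIndependent.map' T.subtype (Submodule.ker_subtype T)
  · have hyT : specialize κ n y ∈ T := ⟨y, hy, rfl⟩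
    refine ⟨t.repr ⟨_, hyT⟩, ?_⟩
    have := congrArg Subtype.val (t.sum_repr ⟨_, hyT⟩)
    simp only [hxt]
    rw [Submodule.coe_sum] at this
    exact this.symm

/-- If `P ⊆ A^m` becomes a free module with basis `b` after inverting `πμ` and has full rank after
specialisation, then it becomes free after inverting `π`. -/
theorem exists_basis_saturation [IsDomain A] [IsDomain R] [IsDomain W]
    [IsPrincipalIdealRing W] [ValuationRing R]
    [IsAdicComplete (Ideal.span {π}) A]
    (h : IsSpecialization q κ π μ) (hb : LinearIndependent A b) {N : ℕ}
    (hN : ∀ x ∈ P, (π * μ) ^ N • x ∈ Submodule.span A (Set.range b))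
    {s : A} (hs : κ s ≠ 0) (hsP : ∀ i, s • Pi.single i 1 ∈ P) :
    ∃ x : Fin m → Fin m → A, LinearIndependent A x ∧ (∀ i, ∃ j : ℕ, π ^ j • x i ∈ P) ∧
      ∀ y ∈ P, π ^ N • y ∈ Submodule.span A (Set.range x) := by
  obtain ⟨x, hx, hli, hgen⟩ := exists_basis_specialize_saturation h hN hs hsP
  refine ⟨x, linearIndependent_of_specialize hli, fun i => (hx i).1, fun y hy => ?_⟩
  have hstep : ∀ y ∈ saturation π μ P b, ∃ a : Fin m → A, ∃ y' ∈ saturation π μ P b,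
      y = ∑ i, a i • x i + π • y' := by
    intro y hy
    -- the given elements satisfy a relation with coefficients in `R`, one of which is `1`
    obtain ⟨U, hU⟩ := exists_coordinates h hb hN hy
    choose V hV using fun i => exists_coordinates h hb hN (hx i)
    -- These are `m + 1` vectors in `R^m`.
    have hdep : ¬ LinearIndependent R
        (fun o : Option (Fin m) => fun j => q (o.elim U V j)) := fun hli => by
      simpa using hli.fintype_card_le_finrank
    obtain ⟨c, hc, o, ho⟩ := Fintype.not_linearIndependent_iff.1 hdep
    obtain ⟨d, hd, c', hc', o', ho'⟩ := exists_eq_mul_of_ne_zero c (Function.ne_iff.2 ⟨o, ho⟩)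
    have hrel : ∀ j, ∑ o, c' o * q (o.elim U V j) = 0 := fun j => by
      have h1 := congrFun hc j
      simp only [Finset.sum_apply, Pi.smul_apply, smul_eq_mul, Pi.zero_apply, hc', mul_assoc,
        ← Finset.mul_sum] at h1
      exact (mul_eq_zero.1 h1).resolve_left hd
    choose a ha using fun o => h.surjective (c' o)
    -- the lifted relation gives an element of `π N`
    set z : Fin m → A := a none • y + ∑ i, a (some i) • x i with hz
    have hzmem : z ∈ saturation π μ P b :=
      add_mem (Submodule.smul_mem _ _ hy) (sum_mem fun i _ => Submodule.smul_mem _ _ (hx i))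
    have hzc : μ ^ N • z = ∑ j, (a none * U j + ∑ i, a (some i) * V i j) • b j := by
      simp only [hz, smul_add, Finset.smul_sum, smul_comm (μ ^ N), hU, hV, add_smul,
        Finset.sum_add_distrib, mul_smul, Finset.sum_smul]
      rw [Finset.sum_comm]
    have hzd : ∀ j, π ∣ a none * U j + ∑ i, a (some i) * V i j := fun j => by
      rw [← h.eq_zero_iff]
      have := hrel j
      simp only [Fintype.sum_option, Option.elim] at this
      simpa [ha] using this
    obtain ⟨z', hz', hzz'⟩ := exists_eq_smul_of_coordinates h hzmem hzd hzc
    -- the coefficient of `y` is a unit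
    have hunit : IsUnit (c' none) := by
      rcases h.isUnit_or (a none) with hu | ⟨e, he⟩
      · rwa [ha] at hu
      exfalso
      -- Otherwise `κ π` divides `κ (a none)`. Specialising `z = π z'` in the basis of the image
      -- then makes `κ π` divide every `κ (a o)`, which contradicts `a o' ≡ 1` modulo `π`.
      obtain ⟨wy, hwy⟩ := hgen y hy
      obtain ⟨wz, hwz⟩ := hgen z' hz'
      have hsp : ∑ i, (κ π * (e * wy i) + κ (a (some i)) - κ π * wz i) •
          specialize κ m (x i) = 0 := by
        have h1 := congrArg (specialize κ m) hzz'
        simp only [hz, map_add, map_sum, LinearMap.map_smulₛₗ, hwy, hwz, he] at h1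
        simp only [sub_smul, add_smul, Finset.sum_sub_distrib, Finset.sum_add_distrib, mul_smul,
          ← Finset.smul_sum]
        rw [mul_smul] at h1
        rw [h1, sub_self]
      have hdvd : ∀ i, κ π ∣ κ (a (some i)) := fun i => by
        have := Fintype.linearIndependent_iff.1 hli _ hsp i
        exact ⟨wz i - e * wy i, by linear_combination this⟩
      have hdvd' : κ π ∣ κ (a o') := by
        cases o' with
        | none => exact ⟨e, he⟩
        | some i => exact hdvd i
      have h1 : π ∣ a o' - 1 := by
        rw [← h.eq_zero_iff, map_sub, ha, ho', map_one, sub_self]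
      refine h.not_isUnit (isUnit_of_dvd_one ?_)
      have h2 := map_dvd κ h1
      rw [map_sub, map_one] at h2
      simpa using dvd_sub hdvd' h2
    obtain ⟨v, hv⟩ := hunit.exists_right_inv
    obtain ⟨v, rfl⟩ := h.surjective v
    have h1 : π ∣ a none * v - 1 := by
      rw [← h.eq_zero_iff, map_sub, map_mul, ha, hv, map_one, sub_self]
    obtain ⟨r, hr⟩ := h1
    refine ⟨fun i => -(v * a (some i)), v • z' - r • y,
      sub_mem (Submodule.smul_mem _ _ hz') (Submodule.smul_mem _ _ hy), ?_⟩
    have h2 : v • z = π • v • z' := by rw [hzz', smul_comm]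
    have h3 : v • z = (1 + π * r) • y + ∑ i, (v * a (some i)) • x i := by
      simp only [hz, smul_add, Finset.smul_sum, smul_smul]
      congr 2
      linear_combination hr
    simp only [neg_smul, Finset.sum_neg_distrib, smul_sub]
    rw [← h2, h3, add_smul, one_smul, mul_smul]
    abel
  have hmem : π ^ N • y ∈ saturation π μ P b :=
    ⟨⟨0, Submodule.smul_mem _ _ (Submodule.smul_mem _ _ hy)⟩, N, by
      rw [smul_smul, ← mul_pow, mul_comm]; exact hN y hy⟩
  obtain ⟨a, ha⟩ := exists_eq_sum_of_forall_exists_eq_add (π := π) _ x hstep _ hmem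
  rw [ha]
  exact sum_mem fun i _ => Submodule.smul_mem _ _ (Submodule.subset_span ⟨i, rfl⟩)

end Saturation

/-! ### Generators after Frobenius -/

theorem exists_pow_smul_mem_of_forall_exists {A M : Type*} [CommRing A] [AddCommGroup M]
    [Module A M] [Module.Finite A M] (a : A) (N : Submodule A M)
    (h : ∀ x, ∃ k : ℕ, a ^ k • x ∈ N) : ∃ k : ℕ, ∀ x, a ^ k • x ∈ N := by
  classical
  obtain ⟨S, hS⟩ := (Module.Finite.fg_top : (⊤ : Submodule A M).FG)
  choose k hk using h
  refine ⟨S.sup k, fun x => ?_⟩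
  have hle : Submodule.span A (S : Set M) ≤ N.comap (LinearMap.lsmul A M (a ^ S.sup k)) := by
    refine Submodule.span_le.2 fun y hy => ?_
    obtain ⟨d, hd⟩ := Nat.exists_eq_add_of_le' (Finset.le_sup (f := k) hy)
    change a ^ S.sup k • y ∈ N
    rw [hd, pow_add, mul_smul]
    exact Submodule.smul_mem _ _ (hk y)
  exact hle (hS ▸ Submodule.mem_top)

section Frobenius

variable {A M : Type*} [CommRing A] [AddCommGroup M] [Module A M] {φ : A →+* A}

/-- The iterates of a semilinear endomorphism. -/
def iterateMap (f : M →ₛₗ[φ] M) (n : ℕ) : M →ₛₗ[φ ^ n] M where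
  toFun := f^[n]
  map_add' := iterate_map_add f n
  map_smul' a x := by
    induction n generalizing a x with
    | zero => simp
    | succ n ih =>
      rw [Function.iterate_succ_apply, map_smulₛₗ, ih, Function.iterate_succ_apply, pow_succ]
      rfl

theorem iterateMap_succ_apply (f : M →ₛₗ[φ] M) (n : ℕ) (x : M) :
    iterateMap f (n + 1) x = f (iterateMap f n x) :=
  Function.iterate_succ_apply' f n x

variable {π μ : A} {f : M →ₛₗ[φ] M}

/-- The hypothesis can be iterated because `f` commutes with `π` and, as `μ` divides `φ μ`, carries
`μM` into itself. Each application costs a factor `π ^ k`. -/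
theorem pow_smul_mem_span_range_iterateMap (hπ : φ π = π) (hμ : μ ∣ φ μ) {k : ℕ}
    (hk : ∀ x, π ^ k • x ∈
      Submodule.span A (Set.range f) ⊔ Ideal.span {μ} • (⊤ : Submodule A M)) (n : ℕ) (x : M) :
    π ^ (k * n) • x ∈
      Submodule.span A (Set.range (iterateMap f n)) ⊔ Ideal.span {μ} • (⊤ : Submodule A M) := by
  induction n generalizing x with
  | zero => exact Submodule.mem_sup_left (Submodule.subset_span ⟨x, by simp [iterateMap]⟩)
  | succ n ih =>
    set G := Submodule.span A (Set.range (iterateMap f (n + 1))) ⊔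
      Ideal.span {μ} • (⊤ : Submodule A M)
    have hmap : Submodule.span A (Set.range (iterateMap f n)) ⊔
        Ideal.span {μ} • (⊤ : Submodule A M) ≤ G.comap f := by
      refine sup_le (Submodule.span_le.2 ?_) (Submodule.smul_le.2 ?_)
      · rintro _ ⟨y, rfl⟩
        refine Submodule.mem_sup_left (Submodule.subset_span ⟨y, ?_⟩)
        exact iterateMap_succ_apply f n y
      · intro r hr y _
        obtain ⟨r, rfl⟩ := Ideal.mem_span_singleton.1 hr
        refine Submodule.mem_sup_right ?_
        rw [map_smulₛₗ]
        refine Submodule.smul_mem_smul (Ideal.mem_span_singleton.2 ?_) trivial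
        rw [map_mul]
        exact hμ.mul_right _
    have hle : Submodule.span A (Set.range f) ⊔ Ideal.span {μ} • (⊤ : Submodule A M) ≤
        G.comap (LinearMap.lsmul A M (π ^ (k * n))) := by
      refine sup_le (Submodule.span_le.2 ?_) fun y hy =>
        Submodule.smul_mem _ _ (Submodule.mem_sup_right hy)
      rintro _ ⟨y, rfl⟩
      have := hmap (ih y)
      rwa [Submodule.mem_comap, map_smulₛₗ, map_pow, hπ] at this
    have := hle (hk x)
    rwa [Submodule.mem_comap, LinearMap.lsmul_apply, smul_smul, ← pow_add] at this

/-- If `e` generates `M` up to a power of `π` modulo `I`, and a power of the Frobenius carries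
elements of `I` close to `0` modulo `μ`, then the images of `e` under an iterate of `f` generate
`M` up to a power of `π` modulo `μ`. -/
theorem exists_pow_smul_mem_span_iterateMap [Module.Finite A M] (hπ : φ π = π) (hμ : μ ∣ φ μ)
    (hjac : π ∈ Ideal.jacobson (⊥ : Ideal A)) {k : ℕ}
    (hk : ∀ x, π ^ k • x ∈
      Submodule.span A (Set.range f) ⊔ Ideal.span {μ} • (⊤ : Submodule A M))
    {ι : Type*} (e : ι → M) (I : Ideal A) {c : ℕ}
    (he : ∀ x, π ^ c • x ∈ Submodule.span A (Set.range e) ⊔ I • (⊤ : Submodule A M))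
    (hI : ∀ w ∈ I, ∃ n₀, ∀ n ≥ n₀, (φ ^ n) w ∈ Ideal.span {π ^ (c + 1)} ⊔ Ideal.span {μ}) :
    ∃ n C : ℕ, ∀ x, π ^ C • x ∈ Submodule.span A (Set.range fun i => iterateMap f n (e i)) ⊔
      Ideal.span {μ} • (⊤ : Submodule A M) := by
  classical
  obtain ⟨r, g, hg⟩ := Module.Finite.exists_fin (R := A) (M := M)
  have hrel : ∀ j, ∃ u ∈ Submodule.span A (Set.range e), ∃ w : Fin r → A, (∀ l, w l ∈ I) ∧
      π ^ c • g j = u + ∑ l, w l • g l := fun j => by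
    obtain ⟨u, hu, v, hv, huv⟩ := Submodule.mem_sup.1 (he (g j))
    rw [← hg, Submodule.mem_ideal_smul_span_iff_exists_sum] at hv
    obtain ⟨w, hw, hwv⟩ := hv
    refine ⟨u, hu, w, hw, ?_⟩
    rw [← huv, ← hwv, Finsupp.sum_fintype _ _ fun i => by simp]
  choose u hu w hw hrel using hrel
  choose n₀ hn₀ using fun j l => hI (w j l) (hw j l)
  set n := Finset.univ.sup fun j => Finset.univ.sup fun l => n₀ j l
  have hle : ∀ j l, n₀ j l ≤ n := fun j l =>
    (Finset.le_sup (f := fun l => n₀ j l) (Finset.mem_univ l)).trans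
      (Finset.le_sup (f := fun j => Finset.univ.sup fun l => n₀ j l) (Finset.mem_univ j))
  set E := Submodule.span A (Set.range fun i => iterateMap f n (e i)) ⊔
    Ideal.span {μ} • (⊤ : Submodule A M) with hE
  set G := Submodule.span A (Set.range fun j => iterateMap f n (g j)) with hG
  -- Nakayama: applying the `n`-th iterate of `f` to `hrel` puts `π ^ c G` inside `E + π (π ^ c G)`.
  -- The extra factor `π` comes from the exponent `c + 1` in `hI`.
  have hGE : Ideal.span {π ^ c} • G ≤ E := by
    refine Submodule.le_of_le_smul_of_le_jacobson_bot (I := Ideal.span {π})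
      (Submodule.FG.smul ⟨{π ^ c}, by simp⟩ (Submodule.fg_span (Set.finite_range _)))
      ((Ideal.span_singleton_le_iff_mem _).2 hjac) ?_
    rw [hG, Submodule.span_smul_span, Submodule.span_le]
    rintro _ ⟨a, ha, _, ⟨j, rfl⟩, rfl⟩
    obtain rfl := ha
    have h1 : π ^ c • iterateMap f n (g j) =
        iterateMap f n (u j) + ∑ l, (φ ^ n) (w j l) • iterateMap f n (g l) := by
      have h2 : (φ ^ n) (π ^ c) = π ^ c := by
        rw [map_pow, RingHom.coe_pow]
        congr 1
        exact Function.iterate_fixed hπ n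
      rw [← h2, ← map_smulₛₗ, hrel, map_add, map_sum]
      simp only [map_smulₛₗ]
    change π ^ c • iterateMap f n (g j) ∈ _
    rw [h1]
    refine add_mem (Submodule.mem_sup_left (Submodule.mem_sup_left ?_)) (sum_mem fun l _ => ?_)
    · have h3 : Submodule.span A (Set.range e) ≤ (Submodule.span A
          (Set.range fun i => iterateMap f n (e i))).comap (iterateMap f n) :=
        Submodule.span_le.2 (by
          rintro _ ⟨i, rfl⟩
          exact Submodule.subset_span ⟨i, rfl⟩)
      exact h3 (hu j)
    · obtain ⟨a, ha, b, hb, hab⟩ := Submodule.mem_sup.1 (hn₀ j l n (hle j l))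
      obtain ⟨a, rfl⟩ := Ideal.mem_span_singleton.1 ha
      rw [← hab, add_smul]
      refine add_mem (Submodule.mem_sup_right ?_)
        (Submodule.mem_sup_left (Submodule.mem_sup_right (Submodule.smul_mem_smul hb trivial)))
      rw [pow_succ', mul_assoc, mul_smul, mul_comm, mul_smul]
      refine Submodule.smul_mem_smul (Ideal.mem_span_singleton_self π) ?_
      rw [← Submodule.span_smul_span]
      have hmem : iterateMap f n (g l) ∈
          Submodule.span A (Set.range fun j => iterateMap f n (g j)) :=
        Submodule.subset_span ⟨l, rfl⟩
      rw [smul_comm]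
      exact Submodule.smul_mem_smul (Ideal.mem_span_singleton_self _)
        (Submodule.smul_mem _ _ hmem)
  have hfG : Submodule.span A (Set.range (iterateMap f n)) ≤ G := by
    refine Submodule.span_le.2 ?_
    rintro _ ⟨x, rfl⟩
    have h3 : Submodule.span A (Set.range g) ≤ G.comap (iterateMap f n) :=
      Submodule.span_le.2 (by
        rintro _ ⟨i, rfl⟩
        exact Submodule.subset_span ⟨i, rfl⟩)
    exact h3 (hg ▸ Submodule.mem_top)
  refine ⟨n, c + k * n, fun x => ?_⟩
  rw [pow_add, mul_smul]
  obtain ⟨y, hy, z, hz, hyz⟩ :=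
    Submodule.mem_sup.1 (pow_smul_mem_span_range_iterateMap hπ hμ hk n x)
  rw [← hyz, smul_add]
  exact add_mem (hGE (Submodule.smul_mem_smul (Ideal.mem_span_singleton_self _) (hfG hy)))
    (Submodule.smul_mem _ _ (Submodule.mem_sup_right hz))

end Frobenius

/-- Cayley–Hamilton: a submodule `H` which is everything up to `r` modulo `μ` is everything up to
an element congruent to a power of `r` modulo `μ`. -/
theorem exists_dvd_sub_pow_and_smul_mem {A M : Type*} [CommRing A] [AddCommGroup M] [Module A M]
    [Module.Finite A M] {r μ : A} (H : Submodule A M)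
    (hH : ∀ x, r • x ∈ H ⊔ Ideal.span {μ} • (⊤ : Submodule A M)) :
    ∃ (s : A) (d : ℕ), μ ∣ s - r ^ d ∧ ∀ x, s • x ∈ H := by
  -- On `M ⧸ H`, multiplication by `r` has image in `μ (M ⧸ H)`. It is therefore a root of a monic
  -- polynomial whose lower coefficients are divisible by `μ`; its value at `r` is the required `s`.
  obtain ⟨P, hP, -, hcoeff, hroot⟩ :=
    LinearMap.exists_monic_and_natDegree_eq_and_coeff_mem_pow_and_aeval_eq_zero A
      (algebraMap A (Module.End A (M ⧸ H)) r) (Ideal.span {μ}) (by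
        rintro _ ⟨x, rfl⟩
        obtain ⟨x, rfl⟩ := H.mkQ_surjective x
        have := Submodule.mem_map_of_mem (f := H.mkQ) (hH x)
        rw [Submodule.map_sup, Submodule.map_smul'', Submodule.map_top, Submodule.range_mkQ,
          Submodule.mkQ_map_self, bot_sup_eq] at this
        exact this)
  refine ⟨P.eval r, P.natDegree, ?_, fun x => ?_⟩
  · rw [hP.as_sum, Polynomial.eval_add, Polynomial.eval_pow, Polynomial.eval_X, ← hP.as_sum,
      add_sub_cancel_left, Polynomial.eval_finsetSum]
    refine Finset.dvd_sum fun i hi => ?_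
    rw [Polynomial.eval_mul, Polynomial.eval_C]
    refine Dvd.dvd.mul_right (Ideal.mem_span_singleton.1 ?_) _
    exact Ideal.pow_le_self (Nat.sub_ne_zero_of_lt (Finset.mem_range.1 hi)) (hcoeff i)
  · rw [Polynomial.aeval_algebraMap_apply] at hroot
    have := LinearMap.congr_fun hroot (H.mkQ x)
    rw [← Submodule.Quotient.mk_eq_zero]
    simpa using this

/-! ### Modules of finite rank -/

/-- A module of rank `m` over a domain is generated, up to torsion, by `m` elements. -/
theorem exists_family_forall_smul_mem_span {W D : Type*} [CommRing W] [IsDomain W]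
    [AddCommGroup D] [Module W D] [Module.Finite W D] :
    ∃ v : Fin (Module.finrank W D) → D, ∀ d : D, ∃ w : W, w ≠ 0 ∧
      w • d ∈ Submodule.span W (Set.range v) := by
  obtain ⟨v, hv⟩ := exists_linearIndependent_of_le_finrank (le_refl (Module.finrank W D))
  refine ⟨v, fun d => ?_⟩
  have hdep : ¬ LinearIndependent W (fun o : Option (Fin (Module.finrank W D)) => o.elim d v) :=
    fun hli => by simpa using hli.fintype_card_le_finrank
  obtain ⟨c, hc, o, ho⟩ := Fintype.not_linearIndependent_iff.1 hdep
  simp only [Fintype.sum_option, Option.elim] at hc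
  refine ⟨c none, fun h0 => ?_, ?_⟩
  · rw [h0, zero_smul, zero_add] at hc
    cases o with
    | none => exact ho h0
    | some i => exact ho (Fintype.linearIndependent_iff.1 hv _ hc i)
  · rw [eq_neg_of_add_eq_zero_left hc]
    exact neg_mem (sum_mem fun i _ => Submodule.smul_mem _ _ (Submodule.subset_span ⟨i, rfl⟩))

theorem mem_ker_smul_top_of_one_tmul_eq_zero {A W M : Type*} [CommRing A] [CommRing W]
    [Algebra A W] [AddCommGroup M] [Module A M] (hW : Function.Surjective (algebraMap A W))
    {x : M} (hx : (1 : W) ⊗ₜ[A] x = 0) :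
    x ∈ RingHom.ker (algebraMap A W) • (⊤ : Submodule A M) := by
  let e : (A ⧸ RingHom.ker (Algebra.ofId A W)) ≃ₐ[A] W :=
    Ideal.quotientKerAlgEquivOfSurjective (f := Algebra.ofId A W) hW
  have h1 : (1 : A ⧸ RingHom.ker (Algebra.ofId A W)) ⊗ₜ[A] x = 0 := by
    apply (TensorProduct.congr e.toLinearEquiv (LinearEquiv.refl A M)).injective
    rw [map_zero, ← hx]
    simp
  have h2 := congrArg (TensorProduct.quotTensorEquivQuotSMul M
    (RingHom.ker (Algebra.ofId A W))) h1
  rw [map_zero, ← map_one (Ideal.Quotient.mk _),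
    TensorProduct.quotTensorEquivQuotSMul_mk_tmul, one_smul] at h2
  exact (Submodule.Quotient.mk_eq_zero _).1 h2

theorem one_tmul_surjective {A W M : Type*} [CommRing A] [CommRing W]
    [Algebra A W] [AddCommGroup M] [Module A M] (hW : Function.Surjective (algebraMap A W)) :
    Function.Surjective fun x : M => (1 : W) ⊗ₜ[A] x := by
  intro d
  induction d with
  | zero => exact ⟨0, by simp⟩
  | tmul w x =>
    obtain ⟨a, rfl⟩ := hW w
    exact ⟨a • x, by simp [Algebra.algebraMap_eq_smul_one, TensorProduct.smul_tmul']⟩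
  | add d d' h h' =>
    obtain ⟨x, rfl⟩ := h
    obtain ⟨x', rfl⟩ := h'
    exact ⟨x + x', TensorProduct.tmul_add _ _ _⟩

/-- Torsion in the quotient of `W ⊗ M` by a maximal independent family is killed by a power of `π`,
by `hπ` and finiteness. After lifting that family to `M`, the remaining error dies in `W ⊗ M`, hence
lies in `ker · M`. -/
theorem exists_generators_of_finrank_tensorProduct {A W M : Type*} [CommRing A] [CommRing W]
    [IsDomain W] [Algebra A W] [AddCommGroup M] [Module A M] [Module.Finite A M]
    (hW : Function.Surjective (algebraMap A W)) (π : A)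
    (hπ : ∀ w : W, w ≠ 0 → ∃ k : ℕ, w ∣ algebraMap A W π ^ k) :
    ∃ (e : Fin (Module.finrank W (W ⊗[A] M)) → M) (c : ℕ), ∀ x, π ^ c • x ∈
      Submodule.span A (Set.range e) ⊔ RingHom.ker (algebraMap A W) • (⊤ : Submodule A M) := by
  obtain ⟨v, hv⟩ := exists_family_forall_smul_mem_span (W := W) (D := W ⊗[A] M)
  obtain ⟨c, hc⟩ := exists_pow_smul_mem_of_forall_exists (algebraMap A W π)
    (Submodule.span W (Set.range v)) fun d => by
      obtain ⟨w, hw, hwd⟩ := hv d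
      obtain ⟨k, y, hy⟩ := hπ w hw
      refine ⟨k, ?_⟩
      rw [hy, mul_comm, mul_smul]
      exact Submodule.smul_mem _ _ hwd
  choose e he using fun i => one_tmul_surjective (M := M) hW (v i)
  refine ⟨e, c, fun x => ?_⟩
  obtain ⟨w, hw⟩ := (Submodule.mem_span_range_iff_exists_fun W).1 (hc (1 ⊗ₜ x))
  choose a ha using fun i => hW (w i)
  have hzero : (1 : W) ⊗ₜ[A] (π ^ c • x - ∑ i, a i • e i) = 0 := by
    rw [TensorProduct.tmul_sub, TensorProduct.tmul_sum, sub_eq_zero]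
    simp only [TensorProduct.tmul_smul, he]
    simp only [← ha] at hw
    rw [← map_pow] at hw
    simp only [algebraMap_smul] at hw
    exact hw.symm
  rw [← sub_add_cancel (π ^ c • x) (∑ i, a i • e i), add_comm]
  exact Submodule.add_mem_sup
    (sum_mem fun i _ => Submodule.smul_mem _ _ (Submodule.subset_span ⟨i, rfl⟩))
    (mem_ker_smul_top_of_one_tmul_eq_zero hW hzero)

/-! ### Bases after localization -/

section Localization

variable {A M : Type*} [CommRing A] [AddCommGroup M] [Module A M]

/-- If `M[1/t]` is free of rank `m`, then `M` contains `m` independent elements which generate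
it up to a power of `t`. -/
theorem exists_linearIndependent_of_free_away [IsDomain A] [Module.Finite A M] {t : A} (ht : t ≠ 0)
    [Module.Free (Localization.Away t) (LocalizedModule.Away t M)]
    [Module.Finite (Localization.Away t) (LocalizedModule.Away t M)] {m : ℕ}
    (hm : Module.finrank (Localization.Away t) (LocalizedModule.Away t M) = m) :
    ∃ g : Fin m → M, LinearIndependent A g ∧
      ∃ N : ℕ, ∀ x, t ^ N • x ∈ Submodule.span A (Set.range g) := by
  have hS : Submonoid.powers t ≤ nonZeroDivisors A := powers_le_nonZeroDivisors_of_noZeroDivisors ht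
  have : IsDomain (Localization.Away t) := IsLocalization.isDomain_localization hS
  let b := Module.finBasisOfFinrankEq _ _ hm
  let ι := LocalizedModule.mkLinearMap (Submonoid.powers t) M
  have hb : ∀ i, ∃ (g : M) (s : Submonoid.powers t), (s : A) • b i = ι g := fun i => by
    obtain ⟨⟨g, s⟩, hgs⟩ := IsLocalizedModule.surj (Submonoid.powers t) ι (b i)
    exact ⟨g, s, hgs⟩
  choose g s hgs using hb
  let u : Fin m → (Localization.Away t)ˣ := fun i =>
    (IsLocalization.map_units (Localization.Away t) (s i)).unit
  have hu : ∀ i, u i • b i = ι (g i) := fun i => by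
    rw [← hgs, Units.smul_def, IsUnit.unit_spec, algebraMap_smul]
  have hli : LinearIndependent (Localization.Away t) (fun i => ι (g i)) := by
    simp only [← hu]
    exact b.linearIndependent.units_smul u
  have hspan : ∀ x, x ∈ Submodule.span (Localization.Away t) (Set.range fun i => ι (g i)) := by
    intro x
    rw [← b.sum_repr x]
    refine sum_mem fun i _ => Submodule.smul_mem _ _ ?_
    rw [← inv_smul_smul (u i) (b i), hu]
    exact Submodule.smul_mem _ _ (Submodule.subset_span ⟨i, rfl⟩)
  refine ⟨g, ?_, exists_pow_smul_mem_of_forall_exists t _ fun x => ?_⟩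
  · refine LinearIndependent.of_comp ι (hli.restrict_scalars ?_)
    intro a a' haa'
    simp only [Algebra.smul_def, mul_one] at haa'
    exact IsLocalization.injective _ hS haa'
  · obtain ⟨c, hc⟩ := (Submodule.mem_span_range_iff_exists_fun _).1 (hspan (ι x))
    obtain ⟨⟨_, k, rfl⟩, hd⟩ :=
      IsLocalization.exist_integer_multiples_of_finite (Submonoid.powers t) c
    choose a ha using hd
    have h1 : ι (t ^ k • x) = ι (∑ i, a i • g i) := by
      rw [map_smul, ← hc, map_sum, Finset.smul_sum]
      refine Finset.sum_congr rfl fun i _ => ?_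
      rw [map_smul, ← smul_assoc, ← algebraMap_smul (Localization.Away t) (a i), ha]
    obtain ⟨⟨_, k', rfl⟩, hk'⟩ := (IsLocalizedModule.eq_iff_exists (Submonoid.powers t) ι).1 h1
    refine ⟨k' + k, ?_⟩
    change t ^ k' • t ^ k • x = t ^ k' • _ at hk'
    rw [pow_add, mul_smul, hk']
    exact Submodule.smul_mem _ _ (sum_mem fun i _ =>
      Submodule.smul_mem _ _ (Submodule.subset_span ⟨i, rfl⟩))

/-- Over a domain, a family which generates a module of the same rank up to torsion is
independent. -/
theorem linearIndependent_of_forall_smul_mem_span [IsDomain A] {m : ℕ} {g h : Fin m → M}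
    (hg : LinearIndependent A g) {s t : A} (hs : s ≠ 0) (ht : t ≠ 0)
    (htg : ∀ x, t • x ∈ Submodule.span A (Set.range g))
    (hsh : ∀ x, s • x ∈ Submodule.span A (Set.range h)) : LinearIndependent A h := by
  choose D hD using fun j => (Submodule.mem_span_range_iff_exists_fun A).1 (htg (h j))
  choose C hC using fun i => (Submodule.mem_span_range_iff_exists_fun A).1 (hsh (g i))
  -- The two transition matrices compose to the scalar `t * s ≠ 0`, so `D` has nonzero determinant.
  have hCD : Matrix.of C * Matrix.of D = (t * s) • (1 : Matrix (Fin m) (Fin m) A) := by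
    ext i l
    have h1 : ∑ l, ((Matrix.of C * Matrix.of D) i l) • g l =
        ∑ l, (((t * s) • (1 : Matrix (Fin m) (Fin m) A)) i l) • g l := by
      have h2 : ∑ l, ((Matrix.of C * Matrix.of D) i l) • g l = t • s • g i := by
        rw [← hC, Finset.smul_sum]
        simp only [Matrix.mul_apply, Matrix.of_apply, Finset.sum_smul, mul_smul]
        rw [Finset.sum_comm]
        refine Finset.sum_congr rfl fun j _ => ?_
        rw [← Finset.smul_sum, hD, smul_comm]
      rw [h2]
      simp [Matrix.smul_apply, Matrix.one_apply, ite_smul, mul_smul]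
    refine sub_eq_zero.1 (Fintype.linearIndependent_iff.1 hg
      (fun l => (Matrix.of C * Matrix.of D) i l - ((t * s) • (1 : Matrix _ _ A)) i l) ?_ l)
    simp only [sub_smul, Finset.sum_sub_distrib, h1, sub_self]
  have hdet : (Matrix.of D).det ≠ 0 := fun h0 => by
    have := congrArg Matrix.det hCD
    rw [Matrix.det_mul, h0, mul_zero, Matrix.det_smul, Matrix.det_one, mul_one] at this
    exact pow_ne_zero _ (mul_ne_zero ht hs) this.symm
  refine Fintype.linearIndependent_iff.2 fun a ha j => ?_
  refine congrFun (Matrix.eq_zero_of_vecMul_eq_zero hdet (v := a) (funext fun i => ?_)) j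
  refine Fintype.linearIndependent_iff.1 hg (fun i => Matrix.vecMul a (Matrix.of D) i) ?_ i
  simp only [Matrix.vecMul, dotProduct, Matrix.of_apply, Finset.sum_smul, mul_smul]
  rw [Finset.sum_comm]
  simp only [← Finset.smul_sum, hD]
  simp only [smul_comm _ t, ← Finset.smul_sum, ha, smul_zero]

/-- Coordinates, up to the factor `s`, with respect to an independent family `h`. -/
theorem exists_linearMap_smul_eq_sum {m : ℕ} {h : Fin m → M} (hh : LinearIndependent A h) {s : A}
    (hs : ∀ x, s • x ∈ Submodule.span A (Set.range h)) :
    ∃ θ : M →ₗ[A] (Fin m → A), ∀ x, s • x = ∑ i, θ x i • h i := by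
  let b := Module.Basis.span hh
  refine ⟨b.equivFun.toLinearMap ∘ₗ (LinearMap.lsmul A M s).codRestrict _ hs, fun x => ?_⟩
  have := congrArg Subtype.val (b.sum_equivFun ⟨s • x, hs x⟩)
  rw [Submodule.coe_sum] at this
  refine this.symm.trans (Finset.sum_congr rfl fun i _ => ?_)
  rw [Submodule.coe_smul, Module.Basis.span_apply]
  rfl

/-- The kernel and cokernel of `ψ` vanish after inverting `π`, so `ψ` exhibits the free module
`A[1/π]^m` as the localization of `M`. -/
theorem free_away_of_linearMap {π : A} {m : ℕ} (ψ : M →ₗ[A] (Fin m → A))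
    (hker : ∀ x, ψ x = 0 → ∃ j : ℕ, π ^ j • x = 0)
    (hrange : ∀ y, ∃ j : ℕ, π ^ j • y ∈ LinearMap.range ψ) :
    Module.Free (Localization.Away π) (LocalizedModule.Away π M) ∧
      Module.Finite (Localization.Away π) (LocalizedModule.Away π M) := by
  let S := Submonoid.powers π
  let ι : (Fin m → A) →ₗ[A] (Fin m → Localization.Away π) :=
    LinearMap.pi fun i => Algebra.linearMap A (Localization.Away π) ∘ₗ LinearMap.proj i
  have hι : IsLocalizedModule S ι := inferInstance
  have hψ : IsLocalizedModule S (ι ∘ₗ ψ) :=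
    { map_units := hι.map_units
      surj := fun y => by
        obtain ⟨⟨z, s⟩, hz⟩ := IsLocalizedModule.surj S ι y
        obtain ⟨j, x, hx⟩ := hrange z
        refine ⟨⟨x, ⟨π ^ j, j, rfl⟩ * s⟩, ?_⟩
        change (π ^ j * (s : A)) • y = ι (ψ x)
        rw [hx, map_smul, mul_smul]
        exact congrArg (π ^ j • ·) hz
      exists_of_eq := fun {x x'} hxx' => by
        obtain ⟨s, hs⟩ := (IsLocalizedModule.eq_iff_exists S ι).1 hxx'
        have h0 : ψ ((s : A) • (x - x')) = 0 := by
          rw [map_smul, map_sub, smul_sub, sub_eq_zero]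
          exact hs
        obtain ⟨j, hj⟩ := hker _ h0
        refine ⟨⟨π ^ j, j, rfl⟩ * s, ?_⟩
        change (π ^ j * (s : A)) • x = (π ^ j * (s : A)) • x'
        rw [mul_smul, mul_smul, ← sub_eq_zero, ← smul_sub, ← smul_sub, hj] }
  let e := (IsLocalizedModule.iso S (ι ∘ₗ ψ)).extendScalarsOfIsLocalization S
    (Localization.Away π)
  exact ⟨Module.Free.of_equiv e.symm, Module.Finite.equiv e.symm⟩

end Localization

/-- Modulo `s`, the element `π ^ C` is a multiple of `μ`. So `s` and `(π * μ) ^ k` together generate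
a power of `π`. -/
theorem exists_pow_smul_eq_zero {A M : Type*} [CommRing A] [AddCommGroup M] [Module A M]
    {s π μ : A} {C : ℕ} (hs : μ ∣ s - π ^ C) {x : M} (hsx : s • x = 0) {k : ℕ}
    (hx : (π * μ) ^ k • x = 0) : ∃ j : ℕ, π ^ j • x = 0 := by
  have h1 : s ∣ (π ^ C) ^ k - (-(s - π ^ C)) ^ k := by
    have := sub_dvd_pow_sub_pow (π ^ C) (-(s - π ^ C)) k
    rwa [neg_sub, sub_sub_cancel, ← neg_sub s] at this
  obtain ⟨r, hr⟩ := h1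
  obtain ⟨y, hy⟩ := hs
  refine ⟨k + C * k, ?_⟩
  have h2 : π ^ (k + C * k) = (π ^ k * r) * s + (-y) ^ k * (π * μ) ^ k := by
    rw [pow_add, pow_mul, mul_pow, eq_add_of_sub_eq hr, hy, ← mul_neg, mul_pow]
    ring
  rw [h2, add_smul, mul_smul, mul_smul _ _ x, hsx, hx, smul_zero, smul_zero, add_zero]

/-! ### The freeness criterion -/

theorem free_away_of_bijective_awayMap {A R W M : Type*} [CommRing A] [IsDomain A]
    [CommRing R] [IsDomain R] [ValuationRing R] [CommRing W] [IsDomain W]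
    [IsPrincipalIdealRing W] [Algebra A W] [AddCommGroup M] [Module A M] [Module.Finite A M]
    {q : A →+* R} {π μ ξ : A} [IsAdicComplete (Ideal.span {π}) A]
    (h : IsSpecialization q (algebraMap A W) π μ)
    (hW : ∀ w : W, w ≠ 0 → ∃ k : ℕ, w ∣ algebraMap A W π ^ k)
    {φ : A →+* A} (hφπ : φ π = π) (hφμ : μ ∣ φ μ) (hφξ : μ ∣ φ ξ - π)
    (hφ : ∀ w ∈ RingHom.ker (algebraMap A W), ∀ c, ∃ n₀, ∀ n ≥ n₀,
      (φ ^ n) w ∈ Ideal.span {π ^ (c + 1)} ⊔ Ideal.span {μ})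
    [Module.Free (Localization.Away (π * μ)) (LocalizedModule.Away (π * μ) M)]
    [Module.Finite (Localization.Away (π * μ)) (LocalizedModule.Away (π * μ) M)]
    (hrank : Module.finrank (Localization.Away (π * μ)) (LocalizedModule.Away (π * μ) M) =
      Module.finrank W (W ⊗[A] M))
    (f : M →ₛₗ[φ] M) (hf : Function.Surjective (awayMap f ξ)) :
    Module.Free (Localization.Away π) (LocalizedModule.Away π M) ∧
      Module.Finite (Localization.Away π) (LocalizedModule.Away π M) := by
  have hμ0 : μ ≠ 0 := fun h0 => h.map_ne_zero (by rw [h0, map_zero])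
  have hπμ : π * μ ≠ 0 := mul_ne_zero h.ne_zero hμ0
  -- the image of `f` generates `M` up to a power of `π` modulo `μ`
  obtain ⟨k, hk⟩ : ∃ k : ℕ, ∀ x, π ^ k • x ∈
      Submodule.span A (Set.range f) ⊔ Ideal.span {μ} • (⊤ : Submodule A M) := by
    obtain ⟨k, hk⟩ := exists_pow_smul_mem_of_forall_exists (φ ξ)
      (Submodule.span A (Set.range f)) fun x => by
        obtain ⟨y, hy⟩ := hf (LocalizedModule.mk x 1)
        induction y using LocalizedModule.induction_on with | _ y s
        rw [awayMap, localizedMap_mk, LocalizedModule.mk_eq] at hy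
        obtain ⟨⟨_, i, rfl⟩, hi⟩ := hy
        obtain ⟨_, j, rfl⟩ := s
        refine ⟨i + j, ?_⟩
        simp only [Submonoid.smul_def, one_smul, map_pow] at hi
        rw [pow_add, mul_smul, ← hi]
        exact Submodule.smul_mem _ _ (Submodule.subset_span ⟨y, rfl⟩)
    refine ⟨k, fun x => ?_⟩
    obtain ⟨r, hr⟩ := hφξ.trans (sub_dvd_pow_sub_pow (φ ξ) π k)
    have h1 : π ^ k • x = φ ξ ^ k • x - (μ * r) • x := by rw [← hr, sub_smul, sub_sub_cancel]
    rw [h1]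
    exact sub_mem (Submodule.mem_sup_left (hk x)) (Submodule.mem_sup_right
      (Submodule.smul_mem_smul (Ideal.mem_span_singleton.2 (dvd_mul_right _ _)) trivial))
  -- hence so do `m` elements, where `m` is the rank
  have hgen := exists_generators_of_finrank_tensorProduct (M := M) h.specialize_surjective π hW
  rw [← hrank] at hgen
  obtain ⟨e, c, he⟩ := hgen
  have hjac : π ∈ Ideal.jacobson (⊥ : Ideal A) :=
    IsAdicComplete.le_jacobson_bot (Ideal.span {π}) (Ideal.mem_span_singleton_self π)
  obtain ⟨n, C, hC⟩ := exists_pow_smul_mem_span_iterateMap hφπ hφμ hjac hk e _ he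
    fun w hw => hφ w hw c
  obtain ⟨s, d, hsd, hs⟩ := exists_dvd_sub_pow_and_smul_mem _ hC
  rw [← pow_mul] at hsd
  have hκs : algebraMap A W s ≠ 0 := by
    have h1 := map_dvd (algebraMap A W) hsd
    rw [h.specialize_eq_zero, zero_dvd_iff, map_sub, sub_eq_zero, map_pow] at h1
    rw [h1]
    exact pow_ne_zero _ h.specialize_ne_zero
  have hs0 : s ≠ 0 := fun h0 => hκs (by rw [h0, map_zero])
  obtain ⟨g, hg, N, hN⟩ := exists_linearIndependent_of_free_away (M := M) hπμ rfl
  have hh := linearIndependent_of_forall_smul_mem_span hg hs0 (pow_ne_zero N hπμ) hN hs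
  obtain ⟨θ, hθ⟩ := exists_linearMap_smul_eq_sum hh hs
  have hθ0 : ∀ x : M, θ x = 0 → s • x = 0 := fun x hx => by simp [hθ, hx]
  -- Torsion of `M` dies after inverting `π * μ`, where `M` is free.
  have htorsion : ∀ x : M, s • x = 0 → (π * μ) ^ N • x = 0 := fun x hx => by
    obtain ⟨a, ha⟩ := (Submodule.mem_span_range_iff_exists_fun A).1 (hN x)
    have h1 : ∑ i, (s * a i) • g i = 0 := by
      simp only [mul_smul, ← Finset.smul_sum, ha]
      rw [smul_comm, hx, smul_zero]
    have h2 := Fintype.linearIndependent_iff.1 hg _ h1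
    rw [← ha]
    exact Finset.sum_eq_zero fun i _ => by
      rw [(mul_eq_zero.1 (h2 i)).resolve_left hs0, zero_smul]
  have hb : LinearIndependent A fun i => θ (g i) := by
    refine Fintype.linearIndependent_iff.2 fun a ha i => ?_
    have h1 : ∑ i, (s * a i) • g i = 0 := by
      simp only [mul_smul, ← Finset.smul_sum]
      exact hθ0 _ (by simpa using ha)
    exact (mul_eq_zero.1 (Fintype.linearIndependent_iff.1 hg _ h1 i)).resolve_left hs0
  have hNP : ∀ x ∈ LinearMap.range θ,
      (π * μ) ^ N • x ∈ Submodule.span A (Set.range fun i => θ (g i)) := by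
    rintro _ ⟨x, rfl⟩
    have := Submodule.mem_map_of_mem (f := θ) (hN x)
    rw [Submodule.map_span, ← Set.range_comp, map_smul] at this
    exact this
  -- The `i`-th member of the family `h` has coordinates `s` times the `i`-th unit vector.
  have hsP : ∀ i, s • Pi.single i 1 ∈ LinearMap.range θ := fun i => by
    refine ⟨iterateMap f n (e i), funext fun j => ?_⟩
    have h1 : ∑ j, (θ (iterateMap f n (e i)) j - (s • Pi.single i (1 : A) : _ → A) j) •
        iterateMap f n (e j) = 0 := by
      simp only [sub_smul, Finset.sum_sub_distrib, ← hθ]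
      simp [Pi.single_apply, ite_smul]
    exact sub_eq_zero.1 (Fintype.linearIndependent_iff.1 hh _ h1 j)
  obtain ⟨x, hx, hxP, hPx⟩ := exists_basis_saturation h hb hNP hκs hsP
  -- coordinates in the basis of the saturation
  let B := Module.Basis.span hx
  have hmem : ∀ y, π ^ N • θ y ∈ Submodule.span A (Set.range x) := fun y => hPx _ ⟨y, rfl⟩
  let ψ := B.equivFun.toLinearMap ∘ₗ ((π ^ N) • θ).codRestrict _ hmem
  have hψ : ∀ y a, π ^ N • θ y = ∑ i, a i • x i → ψ y = a := fun y a hya => by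
    change B.equivFun _ = a
    rw [← LinearEquiv.eq_symm_apply, Module.Basis.equivFun_symm_apply]
    apply Subtype.ext
    rw [Submodule.coe_sum]
    simp only [Submodule.coe_smul, B, Module.Basis.span_apply]
    exact hya
  refine free_away_of_linearMap ψ (fun y hy => ?_) fun a => ?_
  · have h1 : π ^ N • θ y = 0 := congrArg Subtype.val (B.equivFun.map_eq_zero_iff.1 hy)
    have h2 : θ y = 0 := smul_right_injective _ (pow_ne_zero N h.ne_zero)
      (h1.trans (smul_zero _).symm)
    have h3 := hθ0 y h2
    exact exists_pow_smul_eq_zero hsd h3 (htorsion y h3)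
  · choose J hJ using hxP
    choose y hy using hJ
    -- The supremum of the `J i` is a common exponent bringing all basis vectors into the image of
    -- `θ`; the summand `N` is the factor built into `ψ`.
    refine ⟨N + Finset.univ.sup J, ∑ i, (a i * π ^ (Finset.univ.sup J - J i)) • y i, hψ _ _ ?_⟩
    rw [map_sum, Finset.smul_sum]
    refine Finset.sum_congr rfl fun i _ => ?_
    rw [map_smul, hy, smul_smul, smul_smul, Pi.smul_apply, smul_eq_mul, pow_add,
      ← pow_sub_mul_pow π (Finset.le_sup (f := J) (Finset.mem_univ i))]
    congr 1
    ring

/-! ### The ring of integers -/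

section RingOfIntegers

variable {C : Type*} [NormedField C] [IsUltrametricDist C]

theorem mem_ringOfIntegers_iff (x : C) : x ∈ RingOfIntegers C ↔ ‖x‖ ≤ 1 := by
  rw [Valuation.mem_valuationSubring_iff, NormedField.valuation_apply, ← NNReal.coe_le_coe]
  simp

theorem norm_le_one (x : RingOfIntegers C) : ‖(x : C)‖ ≤ 1 := (mem_ringOfIntegers_iff _).1 x.2

theorem dvd_of_norm_le {x y : RingOfIntegers C} (hx : x ≠ 0) (h : ‖(y : C)‖ ≤ ‖(x : C)‖) :
    x ∣ y := by
  have hx' : (x : C) ≠ 0 := fun h0 => hx (Subtype.ext h0)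
  refine ⟨⟨(y : C) / x, (mem_ringOfIntegers_iff _).2 ?_⟩, Subtype.ext ?_⟩
  · rw [norm_div]
    exact div_le_one_of_le₀ h (norm_nonneg _)
  · exact (mul_div_cancel₀ (y : C) hx').symm

theorem norm_le_of_dvd {x y : RingOfIntegers C} (h : x ∣ y) : ‖(y : C)‖ ≤ ‖(x : C)‖ := by
  obtain ⟨z, rfl⟩ := h
  rw [MulMemClass.coe_mul, norm_mul]
  exact mul_le_of_le_one_right (norm_nonneg _) (norm_le_one z)

theorem norm_lt_one_of_not_isUnit {x : RingOfIntegers C} (hx : ¬ IsUnit x) : ‖(x : C)‖ < 1 := by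
  refine lt_of_le_of_ne (norm_le_one x) fun h1 => hx (isUnit_of_dvd_one (dvd_of_norm_le ?_ ?_))
  · rintro rfl
    simp at h1
  · simp [h1]

theorem exists_pow_eq [IsAlgClosed C] {n : ℕ} (hn : n ≠ 0) (x : RingOfIntegers C) :
    ∃ y, y ^ n = x := by
  obtain ⟨y, hy⟩ := IsAlgClosed.exists_pow_nat_eq (x : C) (Nat.pos_of_ne_zero hn)
  refine ⟨⟨y, (mem_ringOfIntegers_iff y).2 ?_⟩, Subtype.ext hy⟩
  rw [← pow_le_one_iff_of_nonneg (norm_nonneg y) hn, ← norm_pow, hy]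
  exact norm_le_one x

variable (C) in
theorem perfectRing_residue [IsAlgClosed C] (p : ℕ) [hp : Fact p.Prime] [CharP (Residue C) p] :
    PerfectRing (Residue C) p :=
  PerfectRing.ofSurjective (Residue C) p fun x => by
    obtain ⟨a, rfl⟩ := IsLocalRing.residue_surjective x
    obtain ⟨b, rfl⟩ := exists_pow_eq hp.out.ne_zero a
    exact ⟨IsLocalRing.residue _ b, by rw [frobenius_def, map_pow]⟩

/-- The ring of integers of a complete field is adically complete for any nonzero nonunit. -/
theorem isAdicComplete_ringOfIntegers [CompleteSpace C] {π : RingOfIntegers C} (h0 : π ≠ 0)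
    (hπ : ¬ IsUnit π) : IsAdicComplete (Ideal.span {π}) (RingOfIntegers C) where
  haus' x hx := by
    simp only [sModEq_span_pow_iff, sub_zero] at hx
    have hlim := tendsto_pow_atTop_nhds_zero_of_lt_one (norm_nonneg _)
      (norm_lt_one_of_not_isUnit hπ)
    have hle := ge_of_tendsto' hlim fun n => by simpa using norm_le_of_dvd (hx n)
    exact Subtype.ext (norm_le_zero_iff.1 hle)
  prec' a ha := by
    simp only [sModEq_span_pow_iff] at ha ⊢
    have hlim := tendsto_pow_atTop_nhds_zero_of_lt_one (norm_nonneg _)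
      (norm_lt_one_of_not_isUnit hπ)
    have hdist : ∀ m n, m ≤ n → ‖(a m : C) - a n‖ ≤ ‖(π : C)‖ ^ m := fun m n hmn => by
      simpa using norm_le_of_dvd (ha hmn)
    have hcauchy : CauchySeq fun n => (a n : C) := by
      refine cauchySeq_of_le_tendsto_0' (fun n => ‖(π : C)‖ ^ n) (fun m n hmn => ?_) hlim
      rw [dist_eq_norm]
      exact hdist m n hmn
    obtain ⟨L, hL⟩ := cauchySeq_tendsto_of_complete hcauchy
    have hL1 : ‖L‖ ≤ 1 := le_of_tendsto' hL.norm fun n => norm_le_one (a n)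
    refine ⟨⟨L, (mem_ringOfIntegers_iff L).2 hL1⟩, fun n => dvd_of_norm_le (pow_ne_zero n h0) ?_⟩
    have hle : ‖(a n : C) - L‖ ≤ ‖(π : C)‖ ^ n :=
      le_of_tendsto (tendsto_const_nhds.sub hL).norm
        (Filter.eventually_atTop.2 ⟨n, fun m hm => hdist n m hm⟩)
    simpa using hle

end RingOfIntegers

/-! ### The tilt -/

section Tilt

variable {C : Type*} [NormedField C] [IsUltrametricDist C]
  {p : ℕ} [hp : Fact p.Prime] [Fact (¬ IsUnit (p : RingOfIntegers C))]

variable (C p) in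
theorem charP_residue : CharP (Residue C) p := by
  refine (CharP.charP_iff_prime_eq_zero hp.out).2 ?_
  rw [← map_natCast (IsLocalRing.residue (RingOfIntegers C)), IsLocalRing.residue_eq_zero_iff,
    IsLocalRing.mem_maximalIdeal]
  exact (Fact.out : ¬ IsUnit (p : RingOfIntegers C))

theorem tiltToResidue_surjective [IsAlgClosed C] : Function.Surjective (tiltToResidue C p) := by
  intro x
  obtain ⟨a, rfl⟩ := IsLocalRing.residue_surjective x
  choose r hr using exists_pow_eq (C := C) hp.out.ne_zero
  let t : Tilt C p := ⟨fun n => Ideal.Quotient.mk _ (r^[n] a), fun n => by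
    rw [← map_pow, Function.iterate_succ_apply', hr]⟩
  exact ⟨t, rfl⟩

instance [CompleteSpace C] [CharZero C] :
    IsAdicComplete (Ideal.span {(p : RingOfIntegers C)}) (RingOfIntegers C) :=
  isAdicComplete_ringOfIntegers
    (fun h0 => hp.out.ne_zero
      (Nat.cast_injective (R := C) (by simpa using congrArg Subtype.val h0)))
    Fact.out

variable [CompleteSpace C] [CharZero C]

theorem tiltToResidue_eq (x : Tilt C p) :
    tiltToResidue C p x = IsLocalRing.residue _ x.untilt := by
  change modPToResidue C p (PreTilt.coeff 0 x) = _
  rw [← PreTilt.mk_untilt_eq_coeff_zero]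
  rfl

theorem mk_untilt_iterate (x : Tilt C p) (n : ℕ) :
    Ideal.Quotient.mk _ (PreTilt.untilt ((frobeniusEquiv (Tilt C p) p).symm^[n] x)) =
      PreTilt.coeff n x := by
  rw [PreTilt.mk_untilt_eq_coeff_zero, PreTilt.coeff_iterate_frobeniusEquiv_symm, zero_add]

theorem untilt_iterate_succ_pow (x : Tilt C p) (n : ℕ) :
    PreTilt.untilt ((frobeniusEquiv (Tilt C p) p).symm^[n + 1] x) ^ p =
      PreTilt.untilt ((frobeniusEquiv (Tilt C p) p).symm^[n] x) := by
  rw [← map_pow, Function.iterate_succ_apply', frobeniusEquiv_symm_pow_p]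

theorem untilt_eq_zero_iff (x : Tilt C p) : x.untilt = 0 ↔ x = 0 := by
  constructor
  · intro hx
    refine Perfection.ext fun n => ?_
    change PreTilt.coeff n x = PreTilt.coeff n 0
    have h1 := PreTilt.untilt_iterate_frobeniusEquiv_symm_pow x n
    rw [hx] at h1
    rw [← mk_untilt_iterate, eq_zero_of_pow_eq_zero h1, map_zero, map_zero]
  · rintro rfl
    exact Perfection.teichmuller_zero

/-- Since `𝒪` is integrally closed, divisibility descends to the untilts of all `p`-power roots. By
cancellation the quotients `c n` satisfy `c (n + 1) ^ p = c n`, so they define an element of the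
tilt. Through this lemma the tilt inherits the divisibility properties of `𝒪`. -/
theorem dvd_of_untilt_dvd {x y : Tilt C p} (h : x.untilt ∣ y.untilt) : x ∣ y := by
  by_cases hx : x.untilt = 0
  · rw [hx, zero_dvd_iff, untilt_eq_zero_iff] at h
    rw [h]
    exact dvd_zero x
  have hx' : ∀ n, PreTilt.untilt ((frobeniusEquiv (Tilt C p) p).symm^[n] x) ≠ 0 := fun n h0 => by
    rw [← PreTilt.untilt_iterate_frobeniusEquiv_symm_pow x n, h0] at hx
    exact hx (zero_pow (pow_ne_zero _ hp.out.ne_zero))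
  have hdvd : ∀ n, PreTilt.untilt ((frobeniusEquiv (Tilt C p) p).symm^[n] x) ∣
      PreTilt.untilt ((frobeniusEquiv (Tilt C p) p).symm^[n] y) := fun n => by
    rwa [← IsIntegrallyClosed.pow_dvd_pow_iff (pow_ne_zero n hp.out.ne_zero),
      PreTilt.untilt_iterate_frobeniusEquiv_symm_pow,
      PreTilt.untilt_iterate_frobeniusEquiv_symm_pow]
  choose c hc using hdvd
  have hcp : ∀ n, c (n + 1) ^ p = c n := fun n => by
    apply mul_left_cancel₀ (hx' n)
    rw [← hc, ← untilt_iterate_succ_pow, ← mul_pow, ← hc, untilt_iterate_succ_pow]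
  let t : Tilt C p := ⟨fun n => Ideal.Quotient.mk _ (c n), fun n => by rw [← map_pow, hcp]⟩
  refine ⟨t, Perfection.ext fun n => ?_⟩
  change PreTilt.coeff n y = PreTilt.coeff n (x * t)
  rw [map_mul, ← mk_untilt_iterate, ← mk_untilt_iterate, hc, map_mul]
  rfl

instance : IsDomain (Tilt C p) := by
  have : Nontrivial (Tilt C p) := CharP.nontrivial_of_char_ne_one hp.out.ne_one
  have : NoZeroDivisors (Tilt C p) := ⟨fun {x y} hxy => by
    rw [← untilt_eq_zero_iff, map_mul, mul_eq_zero] at hxy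
    exact hxy.imp (untilt_eq_zero_iff x).1 (untilt_eq_zero_iff y).1⟩
  exact NoZeroDivisors.to_isDomain _

instance : ValuationRing (Tilt C p) := by
  refine ValuationRing.iff_dvd_total.2 ⟨fun x y => ?_⟩
  exact (ValuationRing.dvd_total x.untilt y.untilt).imp dvd_of_untilt_dvd dvd_of_untilt_dvd

theorem isUnit_or_tiltToResidue_eq_zero (x : Tilt C p) :
    IsUnit x ∨ tiltToResidue C p x = 0 := by
  rw [tiltToResidue_eq, IsLocalRing.residue_eq_zero_iff, IsLocalRing.mem_maximalIdeal]
  refine (em (IsUnit x.untilt)).imp (fun hu => isUnit_of_dvd_one (dvd_of_untilt_dvd ?_)) id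
  rw [map_one]
  exact hu.dvd

/-- The untilt of `y` has norm less than `1`, so its powers eventually become smaller than the
untilt of `x`. -/
theorem exists_dvd_pow {x y : Tilt C p} (hx : x ≠ 0) (hy : tiltToResidue C p y = 0) :
    ∃ n₀, ∀ n ≥ n₀, x ∣ y ^ n := by
  rw [tiltToResidue_eq, IsLocalRing.residue_eq_zero_iff, IsLocalRing.mem_maximalIdeal] at hy
  have hx' : x.untilt ≠ 0 := (untilt_eq_zero_iff x).not.2 hx
  have hx0 : 0 < ‖(x.untilt : C)‖ := norm_pos_iff.2 fun h0 => hx' (Subtype.ext h0)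
  have hlim := tendsto_pow_atTop_nhds_zero_of_lt_one (norm_nonneg _)
    (norm_lt_one_of_not_isUnit hy)
  obtain ⟨n₀, hn₀⟩ := Filter.eventually_atTop.1 (hlim.eventually (gt_mem_nhds hx0))
  refine ⟨n₀, fun n hn => dvd_of_untilt_dvd (dvd_of_norm_le hx' ?_)⟩
  rw [map_pow, SubmonoidClass.coe_pow, norm_pow]
  exact (hn₀ n hn).le

end Tilt

/-! ### The elements `ε`, `μ`, `ξ` -/

section Elements

variable {C : Type*} [NormedField C] [IsUltrametricDist C]
  {p : ℕ} [hp : Fact p.Prime] [Fact (¬ IsUnit (p : RingOfIntegers C))]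

namespace RootSystem

variable (z : RootSystem C p)

theorem coeff_ε (n : ℕ) : PreTilt.coeff n z.ε = Ideal.Quotient.mk _ (z.ζ n) := rfl

theorem tiltToResidue_ε : tiltToResidue C p z.ε = 1 := by
  have h0 : z.ζ 0 = 1 := by simpa using z.primitive 0
  change modPToResidue C p (PreTilt.coeff 0 z.ε) = 1
  rw [coeff_ε, h0, map_one, map_one]

/-- If `ε = 1`, every `ζ (n + 1)` is `1` modulo `p`. Raising to the power `p ^ n` gives `ζ 1 ≡ 1`
modulo `p ^ (n + 1)` for all `n`, hence `ζ 1 = 1`. -/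
theorem ε_ne_one [CompleteSpace C] [CharZero C] : z.ε ≠ 1 := by
  intro h
  have hpow : ∀ n, z.ζ (n + 1) ^ p ^ n = z.ζ 1 := fun n => by
    induction n with
    | zero => simp
    | succ n ih => rw [pow_succ', pow_mul, z.compat, ih]
  have h1 : z.ζ 1 - 1 = 0 := eq_zero_of_forall_pow_dvd (π := (p : RingOfIntegers C)) fun n => by
    have hd : (p : RingOfIntegers C) ∣ z.ζ (n + 1) - 1 := by
      rw [← Ideal.mem_span_singleton, ← Ideal.Quotient.eq_zero_iff_mem, map_sub, ← coeff_ε, h]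
      simp
    have := dvd_sub_pow_of_dvd_sub hd n
    rw [hpow, one_pow] at this
    exact (pow_dvd_pow _ n.le_succ).trans this
  have h2 := (z.primitive 1)
  rw [sub_eq_zero.1 h1, pow_one] at h2
  exact hp.out.ne_one (IsPrimitiveRoot.one.unique h2).symm

theorem constantCoeff_μ : WittVector.constantCoeff z.μ = z.ε - 1 := by
  rw [μ, map_sub, map_one, WittVector.constantCoeff_apply, WittVector.teichmuller_coeff_zero]

theorem crystalline_μ : crystalline C p z.μ = 0 := by
  rw [μ, map_sub, map_one, crystalline, WittVector.map_teichmuller, tiltToResidue_ε, map_one,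
    sub_self]

end RootSystem

theorem frob_teichmuller (x : Tilt C p) :
    frob C p (WittVector.teichmuller p x) = WittVector.teichmuller p (x ^ p) := by
  rw [frob, WittVector.frobenius_eq_map_frobenius, WittVector.map_teichmuller, frobenius_def]

theorem frob_pow_teichmuller (x : Tilt C p) (n : ℕ) :
    (frob C p ^ n) (WittVector.teichmuller p x) = WittVector.teichmuller p (x ^ p ^ n) := by
  induction n with
  | zero => simp
  | succ n ih =>
    rw [pow_succ', RingHom.mul_def, RingHom.comp_apply, ih, frob_teichmuller, ← pow_mul,
      ← pow_succ]

namespace RootSystem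

variable (z : RootSystem C p)

theorem μ_dvd_frob_μ : z.μ ∣ frob C p z.μ := by
  rw [μ, map_sub, map_one, frob_teichmuller, map_pow]
  exact sub_one_dvd_pow_sub_one _ _

theorem μ_dvd_frob_ξ_sub : z.μ ∣ frob C p z.ξ - p := by
  have h1 : frob C p z.ξ - p =
      ∑ i ∈ Finset.range p, (WittVector.teichmuller p z.ε ^ i - 1) := by
    rw [ξ, map_sum]
    simp [frob_teichmuller, frobeniusEquiv_symm_pow_p]
  rw [h1]
  exact Finset.dvd_sum fun i _ => sub_one_dvd_pow_sub_one _ _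

/-- Frobenius is topologically nilpotent modulo `μ` on the kernel of the crystalline
specialisation. -/
theorem exists_frob_pow_mem [CompleteSpace C] [CharZero C] {w : AInf C p}
    (hw : crystalline C p w = 0) (c : ℕ) :
    ∃ n₀, ∀ n ≥ n₀, (frob C p ^ n) w ∈
      Ideal.span {(p : AInf C p) ^ (c + 1)} ⊔ Ideal.span {z.μ} := by
  have hϖ : z.ε - 1 ≠ 0 := sub_ne_zero.2 z.ε_ne_one
  -- These are the Teichmüller digits: `w ≡ ∑ [y i] p ^ i` modulo `p ^ (c + 1)`, summed over `i ≤
  -- c`. Each `y i` reduces to `0` in `k`, and `φⁿ` raises it to the power `p ^ n`, which `(ε - 1) ^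
  -- (c + 1)` eventually divides.
  let y : ℕ → Tilt C p := fun i => ((frobeniusEquiv (Tilt C p) p).symm ^ i) (w.coeff i)
  have hy : ∀ i, tiltToResidue C p (y i) = 0 := fun i => by
    have h1 : y i ^ p ^ i = w.coeff i := by
      simp [y]
    have h2 : tiltToResidue C p (w.coeff i) = 0 := by
      have := congrArg (fun v : WittVector p (Residue C) => v.coeff i) hw
      simpa [crystalline] using this
    rw [← h1, map_pow] at h2
    exact eq_zero_of_pow_eq_zero h2
  choose n₀ hn₀ using fun i => exists_dvd_pow (pow_ne_zero (c + 1) hϖ) (hy i)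
  refine ⟨(Finset.Iic c).sup n₀, fun n hn => ?_⟩
  set J := Ideal.span {(p : AInf C p) ^ (c + 1)} ⊔ Ideal.span {z.μ} with hJ
  -- `[ε - 1]` and `μ` agree modulo `p`, so `[ε - 1]` is `p t` modulo `μ`, and its power is `(p t) ^
  -- (c + 1)` modulo `μ`.
  have hT : WittVector.teichmuller p (z.ε - 1) ^ (c + 1) ∈ J := by
    have h1 : (p : AInf C p) ∣ WittVector.teichmuller p (z.ε - 1) - z.μ := by
      rw [← Ideal.mem_span_singleton, WittVector.mem_span_p_iff_coeff_zero_eq_zero,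
        ← WittVector.constantCoeff_apply, map_sub, constantCoeff_μ,
        WittVector.constantCoeff_apply, WittVector.teichmuller_coeff_zero, sub_self]
    obtain ⟨t, ht⟩ := h1
    have h2 : z.μ ∣ WittVector.teichmuller p (z.ε - 1) ^ (c + 1) - (p * t) ^ (c + 1) := by
      refine dvd_trans (dvd_of_eq ?_) (sub_dvd_pow_sub_pow _ _ _)
      rw [← ht, sub_sub_cancel]
    rw [← sub_add_cancel (WittVector.teichmuller p (z.ε - 1) ^ (c + 1)) ((p * t) ^ (c + 1))]
    refine add_mem (Submodule.mem_sup_right (Ideal.mem_span_singleton.2 h2))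
      (Submodule.mem_sup_left (Ideal.mem_span_singleton.2 ?_))
    rw [mul_pow]
    exact dvd_mul_right _ _
  obtain ⟨r, hr⟩ := WittVector.dvd_sub_sum_teichmuller_iterateFrobeniusEquiv_coeff w c
  rw [sub_eq_iff_eq_add] at hr
  rw [hr, map_add, map_mul, map_pow, map_natCast, map_sum]
  refine add_mem
    (Submodule.mem_sup_left (Ideal.mul_mem_right _ _ (Ideal.mem_span_singleton_self _)))
    (sum_mem fun i hi => ?_)
  rw [map_mul, frob_pow_teichmuller]
  refine Ideal.mul_mem_right _ _ ?_
  have hle : n ≤ p ^ n := (Nat.lt_pow_self hp.out.one_lt).le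
  obtain ⟨v, hv⟩ := hn₀ i (p ^ n) (((Finset.le_sup hi).trans hn).trans hle)
  change WittVector.teichmuller p (y i ^ p ^ n) ∈ J
  rw [hv, map_mul, map_pow]
  exact Ideal.mul_mem_right _ _ hT

theorem isSpecialization [CompleteSpace C] [CharZero C] [IsAlgClosed C] :
    IsSpecialization (WittVector.constantCoeff : AInf C p →+* Tilt C p)
      (algebraMap (AInf C p) (WittVector p (Residue C))) (p : AInf C p) z.μ := by
  have := charP_residue C p
  have := perfectRing_residue C p
  exact
  { surjective := WittVector.constantCoeff_surjective p
    eq_zero_iff := fun a => by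
      rw [← Ideal.mem_span_singleton, WittVector.mem_span_p_iff_coeff_zero_eq_zero,
        WittVector.constantCoeff_apply]
    map_ne_zero := by
      rw [constantCoeff_μ]
      exact sub_ne_zero.2 z.ε_ne_one
    specialize_surjective := WittVector.map_surjective _ tiltToResidue_surjective
    specialize_eq_zero := z.crystalline_μ
    specialize_ne_zero := by
      rw [map_natCast]
      exact WittVector.p_nonzero p _
    not_isUnit := by
      rw [map_natCast]
      exact (WittVector.irreducible p).not_isUnit
    isUnit_or := fun a => by
      rw [map_natCast, ← Ideal.mem_span_singleton, WittVector.mem_span_p_iff_coeff_zero_eq_zero]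
      exact isUnit_or_tiltToResidue_eq_zero (a.coeff 0) }

end RootSystem

end Elements

end AInfModules

end

open AInfModules in
theorem mainTheorem10
    {C : Type*} [NormedField C] [IsUltrametricDist C] [CompleteSpace C] [IsAlgClosed C] [CharZero C]
    {p : ℕ} [Fact p.Prime] [Fact (¬ IsUnit (p : RingOfIntegers C))]
    (z : RootSystem C p)
    (M : Type*) [AddCommGroup M] [Module (AInf C p) M] [Module.FinitePresentation (AInf C p) M]
    (hfree : Module.Free (Localization.Away ((p : AInf C p) * z.μ))
      (LocalizedModule.Away ((p : AInf C p) * z.μ) M))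
    (hfinite : Module.Finite (Localization.Away ((p : AInf C p) * z.μ))
      (LocalizedModule.Away ((p : AInf C p) * z.μ) M))
    (hrank : Module.finrank (Localization.Away ((p : AInf C p) * z.μ))
        (LocalizedModule.Away ((p : AInf C p) * z.μ) M) =
      Module.finrank (WittVector p (Residue C)) (WittVector p (Residue C) ⊗[AInf C p] M))
    (hfrob : ∃ f : M →ₛₗ[frob C p] M, Function.Bijective (awayMap f z.ξ)) :
    Module.Free (Localization.Away (p : AInf C p)) (LocalizedModule.Away (p : AInf C p) M) ∧
      Module.Finite (Localization.Away (p : AInf C p)) (LocalizedModule.Away (p : AInf C p) M) := by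
  obtain ⟨f, hf⟩ := hfrob
  have := charP_residue C p
  have := perfectRing_residue C p
  refine free_away_of_bijective_awayMap (R := Tilt C p) z.isSpecialization (fun w hw => ?_)
    (map_natCast _ p) z.μ_dvd_frob_μ z.μ_dvd_frob_ξ_sub
    (fun w hw c => z.exists_frob_pow_mem hw c) hrank f hf.surjective
  obtain ⟨k, u, rfl⟩ := WittVector.exists_eq_pow_p_mul' w hw
  exact ⟨k, by rw [map_natCast]; exact (u.isUnit.mul_right_dvd).2 dvd_rfl⟩
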